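/- Let $d\ge 1$ and let $\boldsymbol\alpha=(\alpha_1,\dots,\alpha_d)\in\mathbb R^d$ be such that $1,\alpha_1,\dots,\alpha_d$ are linearly independent over $\mathbb Q$ and all lie in a field $K\subset\mathbb R$ with $[K:\mathbb Q]=d+1$ (so they form a $\mathbb Q$-basis of $K$). For $\boldsymbol x\in\mathbb R^d$ put $\langle\boldsymbol x\rangle=\max_{1\le j\le d}\min_{k\in\mathbb Z}|x_j-k|$. Define $N_1=1$ and, for $i\ge 2$, let $N_i$ be the smallest integer $N>N_{i-1}$ with $\langle N\boldsymbol\alpha\rangle<\langle N_{i-1}\boldsymbol\alpha\rangle$; let $\boldsymbol z^{(i)}\in\mathbb Z^d$ be the vector whose $j$-th entry is the nearest integer to $N_i\alpha_j$. For $N\ge1$ and $\boldsymbol z\in\mathbb Z^d$ let \[ P_{N,\boldsymbol z}=\left\{\left(\left\{\tfrac{nz_1}{N}\right\},\dots,\left\{\tfrac{nz_d}{N}\right\}\right) : n=0,1,\dots,N-1\right\}\subset[0,1]^d, \] where $\{x\}=x-\lfloor x\rfloor$. For a finite set $P\subset[0,1]^d$ with at least two points let \[ h(P)=\sup_{\boldsymbol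 x\in[0,1]^d}\min_{\boldsymbol y\in P}\|\boldsymbol x-\boldsymbol y\|_2,\qquad q(P)=\tfrac12\min_{\boldsymbol x\ne\boldsymbol y\in P}\|\boldsymbol x-\boldsymbol y\|_2,\qquad \rho(P)=\frac{h(P)}{q(P)}. \] Then $N_i$ exists for every $i\ge 2$, and $(P_{N_i,\boldsymbol z^{(i)}})_{i\ge 2}$ is a quasi-uniform family of point sets: $P_{N_i,\boldsymbol z^{(i)}}$ consists of exactly $N_i\ge 2$ points for every $i\ge2$, there is a constant $c>1$ with $N_i<N_{i+1}\le cN_i$ for all $i\ge 2$, and there is a constant $C>0$, independent of $i$, with $\rho(P_{N_i,\boldsymbol z^{(i)}})\le C$ for all $i\ge 2$. -/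

import Mathlib

noncomputable section

namespace QuasiUniform

/-- The closed unit cube `[0,1]^d` in Euclidean space. -/
def unitCube (d : ℕ) : Set (EuclideanSpace ℝ (Fin d)) :=
  {x | ∀ j, x j ∈ Set.Icc (0 : ℝ) 1}

/-- Covering radius (fill distance) of `P` with respect to `[0,1]^d`, Euclidean norm. -/
def coveringRadius {d : ℕ} (P : Set (EuclideanSpace ℝ (Fin d))) : ℝ :=
  sSup ((fun x => Metric.infDist x P) '' unitCube d)

/-- Separation radius of `P`: half of the least Euclidean distance between two distinct points. -/
def separationRadius {d : ℕ} (P : Set (EuclideanSpace ℝ (Fin d))) : ℝ :=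
  (1 / 2) * P.infsep

/-- Mesh ratio `h(P) / q(P)` of `P`. It is only used for finite sets with at least two points,
for which `q(P) > 0`. -/
def meshRatio {d : ℕ} (P : Set (EuclideanSpace ℝ (Fin d))) : ℝ :=
  coveringRadius P / separationRadius P

/-- `(P i)` is a quasi-uniform family of point sets in `[0,1]^d`, where `P i` has exactly `N i`
points. The clause `2 ≤ N i` makes the separation radius meaningful. -/
structure IsQuasiUniformFamily {d : ℕ} (N : ℕ → ℕ)
    (P : ℕ → Set (EuclideanSpace ℝ (Fin d))) : Prop where
  subset_unitCube : ∀ i, P i ⊆ unitCube d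
  finite : ∀ i, (P i).Finite
  ncard_eq : ∀ i, (P i).ncard = N i
  two_le : ∀ i, 2 ≤ N i
  growth : ∃ c : ℝ, 1 < c ∧ ∀ i, N i < N (i + 1) ∧ (N (i + 1) : ℝ) ≤ c * N i
  meshRatio_le : ∃ C : ℝ, 0 < C ∧ ∀ i, meshRatio (P i) ≤ C

/-- The rank-1 lattice point set
`P_{N,z} = {({n z_1 / N}, …, {n z_d / N}) : n = 0, …, N - 1}`. -/
def rankOneLattice {d : ℕ} (N : ℕ) (z : Fin d → ℤ) : Set (EuclideanSpace ℝ (Fin d)) :=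
  (fun n : ℕ => WithLp.toLp 2 (fun j => Int.fract ((n : ℝ) * (z j : ℝ) / (N : ℝ)))) '' Set.Iio N

/-- `⟨x⟩ = max_j min_{k ∈ ℤ} |x_j - k|`, the sup-norm distance to the nearest integer vector. -/
def distInt {d : ℕ} (x : Fin d → ℝ) : ℝ :=
  ⨆ j, ⨅ k : ℤ, |x j - (k : ℝ)|

/-- The integers that qualify in the search step of the algorithm after the value `M`:
all `N > M` with `⟨N α⟩ < ⟨M α⟩`. -/
def improvements {d : ℕ} (α : Fin d → ℝ) (M : ℕ) : Set ℕ :=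
  {N | M < N ∧ distInt (fun j => (N : ℝ) * α j) < distInt (fun j => (M : ℝ) * α j)}

/-- The numbers of points produced by the algorithm, indexed from `0`: `algN α i` is `N_{i+1}`.
So `algN α 0 = N_1 = 1`, and each further value is the smallest improvement of the previous one. -/
def algN {d : ℕ} (α : Fin d → ℝ) : ℕ → ℕ
  | 0 => 1
  | i + 1 => sInf (improvements α (algN α i))

/-- The generating vector that the algorithm outputs with `algN α i`: the coordinatewise nearest
integers to `algN α i * α`. -/
def algZ {d : ℕ} (α : Fin d → ℝ) (i : ℕ) : Fin d → ℤ :=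
  fun j => round ((algN α i : ℝ) * α j)

end QuasiUniform

end

/-!
The distance `⟨x⟩` is the norm of the image of `x` in the torus `(ℝ/ℤ)^d`, and `N_i` runs through
the best approximation denominators of the image `ξ` of `α`. The only arithmetic input is that `α`
is badly approximable, `c ≤ N ⟨Nα⟩^d`: if `w ∈ ℤ^{d+1}` is close to `N (1, α)`, then the field
element whose coordinates in the dual basis are `w` has one conjugate of size about `N` and all
others of size `O(⟨Nα⟩)`, while its norm is bounded below because it is a nonzero element of a
finitely generated additive subgroup of the field.

Let `δ = ⟨Nα⟩ / 2` for a best approximation denominator `N`, and let `ζ` be the point of order `N`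
obtained by rounding `N ξ` to `0`. Since `a ζ` differs from `a ξ` by at most `δ` for
`|a| ≤ N / 2`, the points of the lattice generated by `ζ` are `δ`-separated. As `N δ^d` is bounded
below, a volume count shows that the lattice comes within a bounded multiple of `δ` of every point.
-/

open MeasureTheory Metric

namespace QuasiUniform

section NumberField

theorem sum_traceDual_mul_embedding {F L E ι : Type*} [Field F] [Field L] [Algebra F L]
    [FiniteDimensional F L] [Algebra.IsSeparable F L] [Field E] [Algebra F E] [IsAlgClosed E]
    [Fintype ι] [DecidableEq ι] [DecidableEq (L →ₐ[F] E)] (b : Module.Basis ι F L)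
    (σ τ : L →ₐ[F] E) :
    ∑ i, σ (b.traceDual i) * τ (b i) = if σ = τ then 1 else 0 := by
  let B : Matrix ι (L →ₐ[F] E) E := .of fun i σ => σ (b i)
  let D : Matrix (L →ₐ[F] E) ι E := .of fun σ i => σ (b.traceDual i)
  have hBD : B * D = 1 := by
    ext i j
    have h := congrArg (algebraMap F E) (b.trace_mul_traceDual i j)
    rw [trace_eq_sum_embeddings E] at h
    simpa [B, D, Matrix.mul_apply, Matrix.one_apply, apply_ite] using h
  have hcard : Fintype.card ι = Fintype.card (L →ₐ[F] E) := by
    rw [AlgHom.card, Module.finrank_eq_card_basis b]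
  have hDB : D * B = 1 := (Matrix.mul_eq_one_comm_of_card_eq _ _ _ hcard).1 hBD
  simpa [D, B, Matrix.mul_apply, Matrix.one_apply] using congrFun₂ hDB σ τ

variable {F ι : Type*} [Field F] [NumberField F] [Fintype ι]

theorem one_le_abs_norm_of_isIntegral {x : F} (hx : IsIntegral ℤ x) (hx0 : x ≠ 0) :
    1 ≤ |Algebra.norm ℚ x| := by
  obtain ⟨n, hn⟩ := IsIntegrallyClosed.isIntegral_iff.1 (Algebra.isIntegral_norm ℚ hx)
  have hn0 : n ≠ 0 := by
    rintro rfl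
    exact hx0 (Algebra.norm_eq_zero_iff.1 (hn.symm.trans (map_zero _)))
  rw [← hn, eq_intCast]
  exact_mod_cast Int.one_le_abs hn0

theorem exists_pos_le_abs_norm_of_fg {M : Submodule ℤ F} (hM : M.FG) :
    ∃ c : ℚ, 0 < c ∧ ∀ x ∈ M, x ≠ 0 → c ≤ |Algebra.norm ℚ x| := by
  obtain ⟨S, rfl⟩ := hM
  obtain ⟨D, hD0, hD⟩ := exists_integral_multiples ℤ ℚ S
  have hint : ∀ x ∈ Submodule.span ℤ (S : Set F), IsIntegral ℤ (D • x) := fun x hx => by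
    induction hx using Submodule.span_induction with
    | mem x hx => exact hD x hx
    | zero => simpa only [smul_zero] using isIntegral_zero
    | add x y _ _ hx hy => simpa only [smul_add] using hx.add hy
    | smul n x _ hx => simpa only [smul_comm D n x] using hx.smul n
  refine ⟨(|(D : ℚ)| ^ Module.finrank ℚ F)⁻¹, by positivity, fun x hx hx0 => ?_⟩
  have h := one_le_abs_norm_of_isIntegral (hint x hx) (smul_ne_zero hD0 hx0)
  have hDx : D • x = algebraMap ℚ F D * x := by simp
  rw [hDx, map_mul, Algebra.norm_algebraMap, abs_mul, abs_pow] at h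
  rwa [inv_le_iff_one_le_mul₀' (by positivity)]

theorem abs_norm_eq_prod_norm_embeddings (x : F) :
    ((|Algebra.norm ℚ x| : ℚ) : ℝ) = ∏ σ : F →ₐ[ℚ] ℂ, ‖σ x‖ := by
  rw [Rat.cast_abs, ← norm_prod, ← Algebra.norm_eq_prod_embeddings ℚ ℂ x, eq_ratCast,
    Complex.norm_ratCast]

/-- By duality, every conjugate of `∑ i, w i • b.traceDual i` other than the one under `τ` only sees
the deviation of `w` from the line spanned by `τ ∘ b`. -/
theorem exists_norm_embedding_traceDual_le [DecidableEq ι] (b : Module.Basis ι ℚ F)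
    (τ : F →ₐ[ℚ] ℂ) :
    ∃ C : ℝ, 0 < C ∧ ∀ (w : ι → ℤ) (t : ℂ),
      ‖τ (∑ i, w i • b.traceDual i) - t‖ ≤ C * ‖fun i => (w i : ℂ) - t * τ (b i)‖ ∧
      ∀ σ ≠ τ, ‖σ (∑ i, w i • b.traceDual i)‖ ≤ C * ‖fun i => (w i : ℂ) - t * τ (b i)‖ := by
  classical
  obtain ⟨C, hC⟩ := Finite.exists_le fun σ : F →ₐ[ℚ] ℂ => ∑ i, ‖σ (b.traceDual i)‖
  refine ⟨max C 1, by positivity, fun w t => ?_⟩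
  set v : ι → ℂ := fun i => (w i : ℂ) - t * τ (b i)
  have hbound : ∀ σ : F →ₐ[ℚ] ℂ, ‖∑ i, σ (b.traceDual i) * v i‖ ≤ max C 1 * ‖v‖ := fun σ =>
    calc _ ≤ ∑ i, ‖σ (b.traceDual i)‖ * ‖v‖ := norm_sum_le_of_le _ fun i _ =>
          (norm_mul_le _ _).trans (by gcongr; exact norm_le_pi_norm v i)
      _ = (∑ i, ‖σ (b.traceDual i)‖) * ‖v‖ := (Finset.sum_mul ..).symm
      _ ≤ max C 1 * ‖v‖ := by gcongr; exact (hC σ).trans (le_max_left _ _)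
  have hsum : ∀ σ : F →ₐ[ℚ] ℂ, ∑ i, σ (b.traceDual i) * v i =
      σ (∑ i, w i • b.traceDual i) - t * (if σ = τ then 1 else 0) := fun σ => by
    rw [← sum_traceDual_mul_embedding b σ τ, map_sum, Finset.mul_sum, ← Finset.sum_sub_distrib]
    refine Finset.sum_congr rfl fun i _ => ?_
    rw [map_zsmul, zsmul_eq_mul]
    ring
  exact ⟨by simpa [hsum] using hbound τ, fun σ hσ => by simpa [hsum, hσ] using hbound σ⟩

theorem exists_pos_le_norm_mul_norm_sub_pow (b : Module.Basis ι ℚ F) (τ : F →ₐ[ℚ] ℂ) :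
    ∃ c : ℝ, 0 < c ∧ ∀ w : ι → ℤ, w ≠ 0 → ∀ t : ℂ, ‖fun i => (w i : ℂ) - t * τ (b i)‖ ≤ ‖t‖ →
      c ≤ ‖t‖ * ‖fun i => (w i : ℂ) - t * τ (b i)‖ ^ (Module.finrank ℚ F - 1) := by
  classical
  obtain ⟨C, hC0, hC⟩ := exists_norm_embedding_traceDual_le b τ
  obtain ⟨c, hc0, hc⟩ := exists_pos_le_abs_norm_of_fg
    (Submodule.fg_span (R := ℤ) (Set.finite_range b.traceDual))
  set n := Module.finrank ℚ F
  refine ⟨c / ((C + 1) * C ^ (n - 1)), by positivity, fun w hw t ht => ?_⟩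
  obtain ⟨hτ, hne⟩ := hC w t
  set ε := ‖fun i => (w i : ℂ) - t * τ (b i)‖
  set x : F := ∑ i, w i • b.traceDual i
  have hx0 : x ≠ 0 := fun h => hw <| funext <| Fintype.linearIndependent_iff.1
    (b.traceDual.linearIndependent.restrict_scalars' ℤ) w h
  have hxM : x ∈ Submodule.span ℤ (Set.range b.traceDual) :=
    Submodule.sum_mem _ fun i _ => Submodule.smul_mem _ _ (Submodule.subset_span ⟨i, rfl⟩)
  have hτx : ‖τ x‖ ≤ (C + 1) * ‖t‖ := by
    nlinarith [norm_le_norm_sub_add (τ x) t]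
  have hprod : ∏ σ ∈ Finset.univ.erase τ, ‖σ x‖ ≤ (C * ε) ^ (n - 1) := by
    refine (Finset.prod_le_prod (fun _ _ => norm_nonneg _)
      fun σ hσ => hne σ (Finset.ne_of_mem_erase hσ)).trans_eq ?_
    rw [Finset.prod_const, Finset.card_erase_of_mem (Finset.mem_univ _), Finset.card_univ,
      AlgHom.card]
  rw [div_le_iff₀ (by positivity)]
  calc (c : ℝ) ≤ (|Algebra.norm ℚ x| : ℚ) := by exact_mod_cast hc x hxM hx0
    _ = ‖τ x‖ * ∏ σ ∈ Finset.univ.erase τ, ‖σ x‖ := by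
      rw [abs_norm_eq_prod_norm_embeddings,
        Finset.mul_prod_erase Finset.univ (fun σ : F →ₐ[ℚ] ℂ => ‖σ x‖) (Finset.mem_univ τ)]
    _ ≤ (C + 1) * ‖t‖ * (C * ε) ^ (n - 1) := by gcongr
    _ = ‖t‖ * ε ^ (n - 1) * ((C + 1) * C ^ (n - 1)) := by ring

end NumberField

theorem exists_ne_dist_lt_of_measure_univ_lt {X ι : Type*} [PseudoMetricSpace X]
    [MeasurableSpace X] [OpensMeasurableSpace X] [Fintype ι] (μ : Measure X) (x : ι → X) {r : ℝ}
    (h : μ Set.univ < ∑ i, μ (ball (x i) r)) : ∃ i j, i ≠ j ∧ dist (x i) (x j) < 2 * r := by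
  obtain ⟨i, -, j, -, hij, y, hi, hj⟩ := exists_nonempty_inter_of_measure_univ_lt_sum_measure μ
    (fun i _ => measurableSet_ball.nullMeasurableSet) h
  refine ⟨i, j, hij, ?_⟩
  linarith [dist_triangle_right (x i) (x j) y, mem_ball'.1 hi, mem_ball'.1 hj]

/-- By connectedness the distance to `Λ` takes the values `0, δ, …, hδ` as soon as it takes a value
`≥ hδ`; the translates by `Λ` of points realising them would be too many `δ`-separated points. -/
theorem infDist_lt_of_forall_le_norm {A : Type*} [SeminormedAddCommGroup A] [PreconnectedSpace A]
    [MeasurableSpace A] [BorelSpace A] (μ : Measure A) [μ.IsAddLeftInvariant]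
    (Λ : AddSubgroup A) [Finite Λ] {δ : ℝ} (hδ : 0 ≤ δ) (hsep : ∀ g ∈ Λ, g ≠ 0 → δ ≤ ‖g‖) {h : ℕ}
    (hμ : μ Set.univ < (Nat.card Λ * (h + 1) : ℕ) * μ (ball 0 (δ / 2))) (y : A) :
    infDist y Λ < h * δ := by
  have := Fintype.ofFinite Λ
  by_contra! hy
  have hlevel : ∀ s : Fin (h + 1), ∃ x : A, ‖(x : A ⧸ Λ)‖ = s * δ := fun s => by
    refine mem_range_of_exists_le_of_exists_ge (by fun_prop) ⟨0, ?_⟩ ⟨y, ?_⟩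
    · simpa using by positivity
    · rw [QuotientAddGroup.norm_mk]
      exact le_trans (by gcongr; omega) hy
  choose x hx using hlevel
  obtain ⟨⟨g, s⟩, ⟨g', s'⟩, hne, hlt⟩ := exists_ne_dist_lt_of_measure_univ_lt μ
    (fun p : Λ × Fin (h + 1) => (p.1 : A) + x p.2) (r := δ / 2) (by
      have hball (a : A) : μ (ball a (δ / 2)) = μ (ball 0 (δ / 2)) := by
        rw [← measure_vadd μ a (ball 0 (δ / 2)), vadd_ball, vadd_eq_add, add_zero]
      simpa [hball, Nat.card_eq_fintype_card] using hμ)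
  rw [mul_div_cancel₀ δ two_ne_zero, dist_eq_norm] at hlt
  rcases eq_or_ne s s' with rfl | hs
  · have hg : (g - g' : A) ≠ 0 := fun h0 => hne (by rw [Subtype.ext (sub_eq_zero.1 h0)])
    rw [add_sub_add_right_eq_sub] at hlt
    exact (hsep _ (Λ.sub_mem g.2 g'.2) hg).not_gt hlt
  · have hquot : |(s : ℝ) * δ - s' * δ| ≤ ‖(g + x s : A) - (g' + x s')‖ := by
      have hmk (g : Λ) (s) : ((g + x s : A) : A ⧸ Λ) = x s := by simp
      rw [← hx, ← hx, ← hmk g, ← hmk g']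
      exact (abs_norm_sub_norm_le _ _).trans (QuotientAddGroup.norm_mk_le_norm)
    have hss : (1 : ℝ) ≤ |(s : ℝ) - s'| := by
      exact_mod_cast Int.one_le_abs (z := ((s : ℕ) : ℤ) - (s' : ℕ)) (by omega)
    rw [← sub_mul, abs_mul, abs_of_nonneg hδ] at hquot
    nlinarith

section Torus

variable {ι : Type*}

/-- The projection of `ℝ^ι` onto the torus `(ℝ/ℤ)^ι`. The torus carries the supremum norm, so that
`⟨x⟩ = ‖toTorus x‖`. -/
def toTorus : (ι → ℝ) →+ (ι → UnitAddCircle) :=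
  (QuotientAddGroup.mk' (AddSubgroup.zmultiples (1 : ℝ))).compLeft ι

@[simp]
theorem toTorus_apply (x : ι → ℝ) (j : ι) : toTorus x j = (x j : UnitAddCircle) := rfl

@[simp]
theorem toTorus_intCast (k : ι → ℤ) : toTorus (fun j => (k j : ℝ)) = 0 :=
  funext fun j => (AddCircle.coe_eq_zero_iff 1).2 ⟨k j, by simp⟩

theorem toTorus_fract (x : ι → ℝ) : toTorus (fun j => Int.fract (x j)) = toTorus x := by
  have h := toTorus.map_sub x fun j => (⌊x j⌋ : ℝ)
  rwa [toTorus_intCast, sub_zero] at h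

theorem nsmul_toTorus (n : ℕ) (x : ι → ℝ) : n • toTorus x = toTorus fun j => n * x j := by
  rw [← map_nsmul]
  exact congrArg toTorus (funext fun j => nsmul_eq_mul n (x j))

/-- The element of order dividing `N` that generates, in the torus, the rank-1 lattice with `N`
points and generating vector `z`. -/
noncomputable def latticeGen (N : ℕ) (z : ι → ℤ) : ι → UnitAddCircle :=
  toTorus fun j => (z j : ℝ) / N

theorem nsmul_latticeGen (n N : ℕ) (z : ι → ℤ) :
    n • latticeGen N z = toTorus fun j => n * z j / N := by
  simp only [latticeGen, nsmul_toTorus, mul_div_assoc]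

theorem self_nsmul_latticeGen {N : ℕ} (hN : N ≠ 0) (z : ι → ℤ) : N • latticeGen N z = 0 := by
  have hN' : (N : ℝ) ≠ 0 := Nat.cast_ne_zero.2 hN
  simp only [nsmul_latticeGen, mul_div_cancel_left₀ _ hN', toTorus_intCast]

variable [Fintype ι]

theorem norm_toTorus_eq_norm_sub_round (x : ι → ℝ) :
    ‖toTorus x‖ = ‖fun j => x j - round (x j)‖ :=
  have hj (j : ι) : ‖toTorus x j‖ = ‖x j - round (x j)‖ := UnitAddCircle.norm_eq
  le_antisymm
    ((pi_norm_le_iff_of_nonneg (norm_nonneg _)).2 fun j =>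
      (hj j).trans_le (norm_le_pi_norm (fun j => x j - round (x j)) j))
    ((pi_norm_le_iff_of_nonneg (norm_nonneg _)).2 fun j =>
      (hj j).symm.trans_le (norm_le_pi_norm _ j))

theorem norm_toTorus_le (x : ι → ℝ) : ‖toTorus x‖ ≤ ‖x‖ :=
  (pi_norm_le_iff_of_nonneg (norm_nonneg x)).2 fun j =>
    (QuotientAddGroup.norm_mk_le_norm).trans (norm_le_pi_norm x j)

theorem norm_torus_le_half (ξ : ι → UnitAddCircle) : ‖ξ‖ ≤ 1 / 2 :=
  (pi_norm_le_iff_of_nonneg (by positivity)).2 fun j => by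
    simpa using AddCircle.norm_le_half_period 1 one_ne_zero (x := ξ j)

theorem volume_ball_torus (ξ : ι → UnitAddCircle) {r : ℝ} (hr : 0 < r) (hr1 : 2 * r ≤ 1) :
    volume (ball ξ r) = ENNReal.ofReal ((2 * r) ^ Fintype.card ι) := by
  have hj (j : ι) : volume (ball (ξ j) r) = ENNReal.ofReal (2 * r) := by
    rw [← measure_congr AddCircle.closedBall_ae_eq_ball, AddCircle.volume_closedBall,
      min_eq_right hr1]
  rw [volume_pi_ball ξ hr, Finset.prod_congr rfl fun j _ => hj j, Finset.prod_const,
    ENNReal.ofReal_pow (by positivity), Finset.card_univ]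

theorem volume_univ_torus : volume (Set.univ : Set (ι → UnitAddCircle)) = 1 := by
  simp [volume_pi, Measure.pi_univ]

theorem exists_norm_nsmul_lt (ξ : ι → UnitAddCircle) {η : ℝ} (hη : 0 < η) (hη1 : η ≤ 1) :
    ∃ M : ℕ, 0 < M ∧ ‖M • ξ‖ < η ∧ M * η ^ Fintype.card ι ≤ 2 ^ Fintype.card ι := by
  set n := ⌊(2 / η) ^ Fintype.card ι⌋₊
  have hpos : 0 < n := Nat.floor_pos.2 (one_le_pow₀ ((one_le_div hη).2 (by linarith)))
  have hvol : volume (Set.univ : Set (ι → UnitAddCircle)) ≤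
      (n + 1) • volume (closedBall (0 : ι → UnitAddCircle) (η / 2 / 2)) := by
    rw [volume_univ_torus]
    refine le_trans ?_ (nsmul_le_nsmul_right (measure_mono ball_subset_closedBall) _)
    rw [volume_ball_torus _ (by positivity) (by linarith), ← ENNReal.ofReal_nsmul,
      ENNReal.one_le_ofReal, nsmul_eq_mul]
    have h := (Nat.lt_floor_add_one ((2 / η) ^ Fintype.card ι)).le
    rw [show 2 * (η / 2 / 2) = (2 / η)⁻¹ by field_simp, inv_pow, ← div_eq_mul_inv,
      one_le_div (by positivity)]
    exact_mod_cast h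
  obtain ⟨M, ⟨hM1, hMn⟩, hM⟩ := NormedAddCommGroup.exists_norm_nsmul_le ξ hpos (η / 2) hvol
  refine ⟨M, hM1, by linarith, ?_⟩
  rw [← le_div_iff₀ (by positivity), ← div_pow]
  exact (Nat.cast_le.2 hMn).trans (Nat.floor_le (by positivity))

theorem mul_norm_sub_latticeGen_le {N : ℕ} (hN : 0 < N) (α : ι → ℝ) :
    N * ‖toTorus α - latticeGen N fun j => round (N * α j)‖ ≤ ‖N • toTorus α‖ := by
  have hN' : (N : ℝ) ≠ 0 := Nat.cast_ne_zero.2 hN.ne'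
  set x : ι → ℝ := fun j => α j - round (N * α j) / N
  calc N * ‖toTorus α - latticeGen N fun j => round (N * α j)‖
      = N * ‖toTorus x‖ := by rw [latticeGen, ← map_sub]; rfl
    _ ≤ N * ‖x‖ := by gcongr; exact norm_toTorus_le x
    _ = ‖(N : ℝ) • x‖ := by rw [norm_smul, Real.norm_natCast]
    _ = ‖fun j => N * α j - round (N * α j)‖ := by
      congr 1 with j
      simp only [x, Pi.smul_apply, smul_eq_mul, mul_sub, mul_div_cancel₀ _ hN']
    _ = ‖N • toTorus α‖ := by rw [nsmul_toTorus, norm_toTorus_eq_norm_sub_round]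

theorem norm_coe_unitAddCircle_eq_iInf (x : ℝ) : ‖(x : UnitAddCircle)‖ = ⨅ k : ℤ, |x - k| := by
  rw [UnitAddCircle.norm_eq]
  exact le_antisymm (le_ciInf (round_le x))
    (ciInf_le (f := fun k : ℤ => |x - k|) ⟨0, Set.forall_mem_range.2 fun _ => abs_nonneg _⟩
      (round x))

theorem distInt_eq_norm_toTorus {d : ℕ} (x : Fin d → ℝ) : distInt x = ‖toTorus x‖ := by
  rw [← PiLp.norm_toLp, PiLp.norm_eq_ciSup]
  simp only [distInt, toTorus_apply, norm_coe_unitAddCircle_eq_iInf]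

theorem distInt_natCast_mul {d : ℕ} (n : ℕ) (α : Fin d → ℝ) :
    distInt (fun j => n * α j) = ‖n • toTorus α‖ := by
  rw [distInt_eq_norm_toTorus, nsmul_toTorus]

end Torus

section BestApproximation

variable {A : Type*} [SeminormedAddCommGroup A] {ξ ζ : A} {N : ℕ}

/-- `N` is a best approximation denominator of `ξ`: the multiple `N • ξ` is closer to `0` than all
earlier positive multiples of `ξ`. -/
structure IsBestApprox (ξ : A) (N : ℕ) : Prop where
  pos : 0 < N
  norm_lt : ∀ M, 0 < M → M < N → ‖N • ξ‖ < ‖M • ξ‖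

theorem isBestApprox_one (ξ : A) : IsBestApprox ξ 1 :=
  ⟨one_pos, fun _ _ _ => by omega⟩

theorem IsBestApprox.le_of_norm_lt (h : IsBestApprox ξ N) {M : ℕ} (hM : 0 < M)
    (hlt : ‖M • ξ‖ < ‖N • ξ‖) : N ≤ M :=
  not_lt.1 fun hMN => (h.norm_lt M hM hMN).not_gt hlt

theorem IsBestApprox.of_isLeast (h : IsBestApprox ξ N) {N' : ℕ}
    (hN' : IsLeast {M | N < M ∧ ‖M • ξ‖ < ‖N • ξ‖} N') : IsBestApprox ξ N' := by
  obtain ⟨⟨hNN', hlt⟩, hmin⟩ := hN'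
  refine ⟨h.pos.trans hNN', fun M hM hMN' => hlt.trans_le ?_⟩
  by_contra! hM_lt
  have hNM : N < M := (h.le_of_norm_lt hM hM_lt).lt_of_ne (by rintro rfl; exact lt_irrefl _ hM_lt)
  exact hMN'.not_ge (hmin ⟨hNM, hM_lt⟩)

theorem IsBestApprox.norm_nsmul_lt_norm_zsmul (h : IsBestApprox ξ N) {a : ℤ} (ha : a ≠ 0)
    (haN : a.natAbs < N) : ‖N • ξ‖ < ‖a • ξ‖ := by
  rw [← norm_natAbs_smul]
  exact h.norm_lt _ (Int.natAbs_pos.2 ha) haN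

theorem IsBestApprox.half_norm_le_norm_zsmul (h : IsBestApprox ξ N) (hζ : N • ζ = 0)
    (hclose : N * ‖ξ - ζ‖ ≤ ‖N • ξ‖) {a : ℤ} (ha : ¬ (N : ℤ) ∣ a) : ‖N • ξ‖ / 2 ≤ ‖a • ζ‖ := by
  set b := a.bmod N
  have hab : a • ζ = b • ζ := by
    nth_rw 1 [← Int.bmod_add_bdiv' a N]
    rw [add_zsmul, mul_zsmul, natCast_zsmul, hζ, zsmul_zero, add_zero]
  have hb0 : b ≠ 0 := fun hb => ha (Int.dvd_of_bmod_eq_zero hb)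
  have hbN : 2 * b.natAbs ≤ N := by
    have := Int.le_bmod (x := a) h.pos
    have := Int.bmod_le (x := a) h.pos
    omega
  have hbest : ‖N • ξ‖ < ‖b • ξ‖ := h.norm_nsmul_lt_norm_zsmul hb0 (by omega)
  have hdiff : ‖b • (ξ - ζ)‖ ≤ ‖N • ξ‖ / 2 :=
    calc ‖b • (ξ - ζ)‖ ≤ b.natAbs * ‖ξ - ζ‖ := by
          rw [← norm_natAbs_smul]
          exact norm_nsmul_le
      _ ≤ N / 2 * ‖ξ - ζ‖ := by
        gcongr
        rw [le_div_iff₀' two_pos]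
        exact_mod_cast hbN
      _ ≤ ‖N • ξ‖ / 2 := by linarith
  rw [zsmul_sub] at hdiff
  rw [hab]
  linarith [norm_sub_norm_le (b • ξ) (b • ζ)]

theorem IsBestApprox.half_norm_le_norm_of_mem_zmultiples (h : IsBestApprox ξ N) (hζ : N • ζ = 0)
    (hclose : N * ‖ξ - ζ‖ ≤ ‖N • ξ‖) {g : A} (hg : g ∈ AddSubgroup.zmultiples ζ) (hg0 : g ≠ 0) :
    ‖N • ξ‖ / 2 ≤ ‖g‖ := by
  obtain ⟨a, rfl⟩ := hg
  refine h.half_norm_le_norm_zsmul hζ hclose fun ⟨k, hk⟩ => hg0 ?_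
  simp only [hk, mul_comm (N : ℤ), mul_zsmul, natCast_zsmul, hζ, zsmul_zero]

theorem IsBestApprox.addOrderOf_eq (h : IsBestApprox ξ N) (hζ : N • ζ = 0)
    (hclose : N * ‖ξ - ζ‖ ≤ ‖N • ξ‖) (hpos : 0 < ‖N • ξ‖) : addOrderOf ζ = N := by
  refine Nat.dvd_antisymm (addOrderOf_dvd_of_nsmul_eq_zero hζ) ?_
  by_contra hdvd
  have hhalf := h.half_norm_le_norm_zsmul hζ hclose (mt Int.natCast_dvd_natCast.1 hdvd)
  rw [natCast_zsmul, addOrderOf_nsmul_eq_zero, norm_zero] at hhalf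
  linarith

theorem IsBestApprox.exists_improvement {ι : Type*} [Fintype ι] {ξ : ι → UnitAddCircle}
    (h : IsBestApprox ξ N) (hpos : 0 < ‖N • ξ‖) :
    ∃ M, N < M ∧ ‖M • ξ‖ < ‖N • ξ‖ ∧ M * ‖N • ξ‖ ^ Fintype.card ι ≤ 2 ^ Fintype.card ι := by
  obtain ⟨M, hM0, hlt, hle⟩ :=
    exists_norm_nsmul_lt ξ hpos ((norm_torus_le_half _).trans (by norm_num))
  exact ⟨M, (h.le_of_norm_lt hM0 hlt).lt_of_ne (by rintro rfl; exact lt_irrefl _ hlt), hlt, hle⟩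

end BestApproximation

section RankOneLattice

variable {d N : ℕ} {z : Fin d → ℤ}

theorem rankOneLattice_subset_unitCube : rankOneLattice N z ⊆ unitCube d := by
  rintro _ ⟨n, -, rfl⟩ j
  exact ⟨Int.fract_nonneg _, (Int.fract_lt_one _).le⟩

theorem finite_rankOneLattice : (rankOneLattice N z).Finite :=
  (Set.finite_Iio N).image _

theorem toTorus_fract_mul_div (n : ℕ) :
    toTorus (fun j => Int.fract ((n : ℝ) * z j / N)) = n • latticeGen N z := by
  rw [toTorus_fract, nsmul_latticeGen]

theorem toTorus_mem_zmultiples {p : EuclideanSpace ℝ (Fin d)} (hp : p ∈ rankOneLattice N z) :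
    toTorus p.ofLp ∈ AddSubgroup.zmultiples (latticeGen N z) := by
  obtain ⟨n, -, rfl⟩ := hp
  exact toTorus_fract_mul_div n ▸ AddSubgroup.nsmul_mem_zmultiples _ n

theorem exists_mem_rankOneLattice_toTorus_eq (hN : 0 < N) {g : Fin d → UnitAddCircle}
    (hg : g ∈ AddSubgroup.zmultiples (latticeGen N z)) :
    ∃ p ∈ rankOneLattice N z, toTorus p.ofLp = g := by
  classical
  have hζ : N • latticeGen N z = 0 := self_nsmul_latticeGen hN.ne' z
  have hfin : IsOfFinAddOrder (latticeGen N z) := isOfFinAddOrder_iff_nsmul_eq_zero.2 ⟨N, hN, hζ⟩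
  obtain ⟨n, hn, rfl⟩ := Finset.mem_image.1 (hfin.mem_zmultiples_iff_mem_range_addOrderOf.1 hg)
  have hnN : n < N := (Finset.mem_range.1 hn).trans_le (addOrderOf_le_of_nsmul_eq_zero hN hζ)
  exact ⟨_, ⟨n, hnN, rfl⟩, toTorus_fract_mul_div n⟩

theorem injOn_nsmul_latticeGen (hord : addOrderOf (latticeGen N z) = N) :
    Set.InjOn (· • latticeGen N z) (Set.Iio N) := by
  simpa only [hord] using nsmul_injOn_Iio_addOrderOf (x := latticeGen N z)

theorem ncard_rankOneLattice (hord : addOrderOf (latticeGen N z) = N) :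
    (rankOneLattice N z).ncard = N := by
  refine (Set.InjOn.ncard_image fun n hn m hm hnm => ?_).trans (Set.ncard_Iio_nat N)
  apply injOn_nsmul_latticeGen hord hn hm
  simp only [← toTorus_fract_mul_div]
  exact congrArg toTorus (WithLp.toLp_injective 2 hnm)

theorem norm_toTorus_sub_le_dist (x y : EuclideanSpace ℝ (Fin d)) :
    ‖toTorus x.ofLp - toTorus y.ofLp‖ ≤ dist x y :=
  calc ‖toTorus x.ofLp - toTorus y.ofLp‖ = ‖toTorus (x.ofLp - y.ofLp)‖ := by rw [map_sub]
    _ ≤ ‖x.ofLp - y.ofLp‖ := norm_toTorus_le _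
    _ = dist x.ofLp y.ofLp := (dist_eq_norm ..).symm
    _ ≤ dist x y := by simpa using (PiLp.lipschitzWith_ofLp 2 _).dist_le_mul x y

theorem half_le_separationRadius (hN : 2 ≤ N) (hord : addOrderOf (latticeGen N z) = N) {δ : ℝ}
    (hsep : ∀ g ∈ AddSubgroup.zmultiples (latticeGen N z), g ≠ 0 → δ ≤ ‖g‖) :
    δ / 2 ≤ separationRadius (rankOneLattice N z) := by
  have hnt : (rankOneLattice N z).Nontrivial := by
    have := (finite_rankOneLattice (N := N) (z := z)).to_subtype
    rwa [← Set.one_lt_ncard_iff_nontrivial, ncard_rankOneLattice hord]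
  suffices δ ≤ (rankOneLattice N z).infsep by rw [separationRadius]; linarith
  refine hnt.le_infsep fun p hp q hq hpq => ?_
  refine (hsep _ (sub_mem (toTorus_mem_zmultiples hp) (toTorus_mem_zmultiples hq)) ?_).trans
    (norm_toTorus_sub_le_dist p q)
  obtain ⟨n, hn, rfl⟩ := hp
  obtain ⟨m, hm, rfl⟩ := hq
  refine sub_ne_zero.2 fun h => hpq ?_
  have hnm : n • latticeGen N z = m • latticeGen N z :=
    (toTorus_fract_mul_div n).symm.trans (h.trans (toTorus_fract_mul_div m))
  rw [injOn_nsmul_latticeGen hord hn hm hnm]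

/-- The contraction `x ↦ r + (1 - 2r) x` keeps the ball of radius `r` away from `0` and `1`, so that
distances in the circle become distances in `[0,1]`. -/
theorem abs_sub_fract_le {x s r : ℝ} (hx : x ∈ Set.Icc (0 : ℝ) 1)
    (h : ‖((r + (1 - 2 * r) * x - s : ℝ) : UnitAddCircle)‖ < r) : |x - Int.fract s| ≤ 2 * r := by
  obtain ⟨hx0, hx1⟩ := hx
  rw [UnitAddCircle.norm_eq, sub_sub, abs_lt] at h
  set t := s + round (r + (1 - 2 * r) * x - s)
  have hfract : Int.fract s = Int.fract t := (Int.fract_add_intCast ..).symm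
  rcases le_total 1 (2 * r) with hr | hr
  · rw [abs_le]
    constructor <;> linarith [Int.fract_nonneg s, Int.fract_lt_one s]
  · have ht01 : Int.fract t = t :=
      Int.fract_eq_self.2 ⟨by nlinarith, by nlinarith⟩
    rw [hfract, ht01, abs_le]
    constructor <;> nlinarith

theorem exists_mem_rankOneLattice_abs_sub_le (hN : 0 < N) {r : ℝ}
    (hcov : ∀ y : Fin d → UnitAddCircle, infDist y (AddSubgroup.zmultiples (latticeGen N z)) < r)
    {x : EuclideanSpace ℝ (Fin d)} (hx : x ∈ unitCube d) :
    ∃ p ∈ rankOneLattice N z, ∀ j, |x j - p j| ≤ 2 * r := by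
  obtain ⟨g, hg, hdist⟩ := (infDist_lt_iff ⟨0, zero_mem _⟩).1
    (hcov (toTorus fun j => r + (1 - 2 * r) * x j))
  obtain ⟨_, ⟨n, hn, rfl⟩, rfl⟩ := exists_mem_rankOneLattice_toTorus_eq hN hg
  refine ⟨_, ⟨n, hn, rfl⟩, fun j => ?_⟩
  rw [dist_eq_norm, ← map_sub] at hdist
  have hj := (norm_le_pi_norm _ j).trans_lt hdist
  simpa using abs_sub_fract_le (hx j) hj

theorem coveringRadius_rankOneLattice_le (hN : 0 < N) {r : ℝ} (hr : 0 ≤ r)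
    (hcov : ∀ y : Fin d → UnitAddCircle, infDist y (AddSubgroup.zmultiples (latticeGen N z)) < r) :
    coveringRadius (rankOneLattice N z) ≤ √d * (2 * r) := by
  refine Real.sSup_le ?_ (by positivity)
  rintro _ ⟨x, hx, rfl⟩
  obtain ⟨p, hp, hxp⟩ := exists_mem_rankOneLattice_abs_sub_le hN hcov hx
  refine (infDist_le_dist_of_mem hp).trans ?_
  have hsum : ∑ j, dist (x j) (p j) ^ 2 ≤ d * (2 * r) ^ 2 := by
    have h := Finset.sum_le_card_nsmul Finset.univ (fun j => dist (x j) (p j) ^ 2) ((2 * r) ^ 2)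
      fun j _ => pow_le_pow_left₀ dist_nonneg (hxp j) 2
    simpa only [Finset.card_univ, Fintype.card_fin, nsmul_eq_mul] using h
  calc dist x p = √(∑ j, dist (x j) (p j) ^ 2) := EuclideanSpace.dist_eq x p
    _ ≤ √(d * (2 * r) ^ 2) := Real.sqrt_le_sqrt hsum
    _ = √d * (2 * r) := by rw [Real.sqrt_mul (by positivity), Real.sqrt_sq (by positivity)]

theorem meshRatio_rankOneLattice_le (hN : 2 ≤ N) (hord : addOrderOf (latticeGen N z) = N) {δ : ℝ}
    (hδ : 0 < δ) (hδ1 : δ ≤ 1)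
    (hsep : ∀ g ∈ AddSubgroup.zmultiples (latticeGen N z), g ≠ 0 → δ ≤ ‖g‖) {h : ℕ}
    (hh : 1 < (N * (h + 1)) * δ ^ d) : meshRatio (rankOneLattice N z) ≤ 4 * √d * h := by
  have hfin : Finite (AddSubgroup.zmultiples (latticeGen N z)) :=
    Nat.finite_of_card_ne_zero (by rw [Nat.card_zmultiples, hord]; omega)
  have hcov : ∀ y : Fin d → UnitAddCircle,
      infDist y (AddSubgroup.zmultiples (latticeGen N z)) < h * δ :=
    infDist_lt_of_forall_le_norm volume (AddSubgroup.zmultiples (latticeGen N z)) hδ.le hsep <| by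
      rw [volume_univ_torus, volume_ball_torus _ (by positivity) (by linarith),
        Nat.card_zmultiples, hord, mul_div_cancel₀ δ two_ne_zero, Fintype.card_fin,
        ← nsmul_eq_mul, ← ENNReal.ofReal_nsmul, ENNReal.one_lt_ofReal, nsmul_eq_mul]
      exact_mod_cast hh
  have hh_le := coveringRadius_rankOneLattice_le (by omega) (by positivity) hcov
  have hq_ge := half_le_separationRadius hN hord hsep
  rw [meshRatio, div_le_iff₀ (by linarith)]
  calc coveringRadius (rankOneLattice N z) ≤ 4 * √d * h * (δ / 2) := by linarith
    _ ≤ 4 * √d * h * separationRadius (rankOneLattice N z) := by gcongr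

end RankOneLattice

section Algorithm

variable {d : ℕ} {α : Fin d → ℝ} {N : ℕ}

theorem improvements_eq (α : Fin d → ℝ) (N : ℕ) :
    improvements α N = {M | N < M ∧ ‖M • toTorus α‖ < ‖N • toTorus α‖} := by
  simp only [improvements, distInt_natCast_mul]

/-- `α` is badly approximable: up to a constant, Dirichlet's bound for simultaneous approximation
is optimal. -/
def IsBadlyApproximable (α : Fin d → ℝ) : Prop :=
  ∃ c : ℝ, 0 < c ∧ ∀ N : ℕ, 0 < N → c ≤ N * distInt (fun j => N * α j) ^ d

theorem IsBadlyApproximable.exists_le_mul_norm_pow (hα : IsBadlyApproximable α) :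
    ∃ c : ℝ, 0 < c ∧ ∀ N : ℕ, 0 < N → c ≤ N * ‖N • toTorus α‖ ^ d := by
  simpa only [IsBadlyApproximable, distInt_natCast_mul] using hα

theorem IsBadlyApproximable.norm_pos (hα : IsBadlyApproximable α) (hd : 1 ≤ d) (hN : 0 < N) :
    0 < ‖N • toTorus α‖ := by
  obtain ⟨c, hc0, hc⟩ := hα.exists_le_mul_norm_pow
  by_contra! h
  have hcN := hc N hN
  rw [h.antisymm (norm_nonneg _), zero_pow (by omega), mul_zero] at hcN
  exact hcN.not_gt hc0

theorem isLeast_improvements (hα : IsBadlyApproximable α) (hd : 1 ≤ d)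
    (h : IsBestApprox (toTorus α) N) : IsLeast (improvements α N) (sInf (improvements α N)) := by
  obtain ⟨M, hNM, hlt, -⟩ := h.exists_improvement (hα.norm_pos hd h.pos)
  exact isLeast_csInf ⟨M, by rw [improvements_eq]; exact ⟨hNM, hlt⟩⟩

theorem isBestApprox_algN (hα : IsBadlyApproximable α) (hd : 1 ≤ d) (i : ℕ) :
    IsBestApprox (toTorus α) (algN α i) := by
  induction i with
  | zero => exact isBestApprox_one _
  | succ i ih => exact ih.of_isLeast (improvements_eq α _ ▸ isLeast_improvements hα hd ih)

theorem isLeast_algN_succ (hα : IsBadlyApproximable α) (hd : 1 ≤ d) (i : ℕ) :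
    IsLeast (improvements α (algN α i)) (algN α (i + 1)) :=
  isLeast_improvements hα hd (isBestApprox_algN hα hd i)

theorem algN_lt_succ (hα : IsBadlyApproximable α) (hd : 1 ≤ d) (i : ℕ) :
    algN α i < algN α (i + 1) :=
  (isLeast_algN_succ hα hd i).1.1

theorem two_le_algN_succ (hα : IsBadlyApproximable α) (hd : 1 ≤ d) (i : ℕ) :
    2 ≤ algN α (i + 1) := by
  have := algN_lt_succ hα hd i
  have := (isBestApprox_algN hα hd i).pos
  omega

theorem exists_algN_succ_le_mul (hα : IsBadlyApproximable α) (hd : 1 ≤ d) :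
    ∃ C : ℝ, 1 < C ∧ ∀ i, (algN α (i + 1) : ℝ) ≤ C * algN α i := by
  obtain ⟨c, hc0, hc⟩ := hα.exists_le_mul_norm_pow
  refine ⟨max 2 (2 ^ d / c), lt_max_of_lt_left one_lt_two, fun i => ?_⟩
  have hbest := isBestApprox_algN hα hd i
  have hpos := hα.norm_pos hd hbest.pos
  obtain ⟨M, hNM, hlt, hM⟩ := hbest.exists_improvement hpos
  rw [Fintype.card_fin] at hM
  have hmem : M ∈ improvements α (algN α i) := by rw [improvements_eq]; exact ⟨hNM, hlt⟩
  calc (algN α (i + 1) : ℝ) ≤ M := Nat.cast_le.2 ((isLeast_algN_succ hα hd i).2 hmem)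
    _ ≤ 2 ^ d / ‖algN α i • toTorus α‖ ^ d := (le_div_iff₀ (by positivity)).2 hM
    _ ≤ 2 ^ d / c * algN α i := by
      rw [div_mul_eq_mul_div, div_le_div_iff₀ (by positivity) hc0, mul_assoc]
      gcongr
      exact hc _ hbest.pos
    _ ≤ max 2 (2 ^ d / c) * algN α i := by gcongr; exact le_max_right _ _

theorem addOrderOf_latticeGen_algN (hα : IsBadlyApproximable α) (hd : 1 ≤ d) (i : ℕ) :
    addOrderOf (latticeGen (algN α i) (algZ α i)) = algN α i :=
  have h := isBestApprox_algN hα hd i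
  h.addOrderOf_eq (self_nsmul_latticeGen h.pos.ne' _) (mul_norm_sub_latticeGen_le h.pos α)
    (hα.norm_pos hd h.pos)

theorem exists_meshRatio_algN_le (hα : IsBadlyApproximable α) (hd : 1 ≤ d) :
    ∃ C : ℝ, 0 < C ∧
      ∀ i, meshRatio (rankOneLattice (algN α (i + 1)) (algZ α (i + 1))) ≤ C := by
  obtain ⟨c, hc0, hc⟩ := hα.exists_le_mul_norm_pow
  obtain ⟨h, hh⟩ := exists_nat_gt (2 ^ d / c)
  have : (0 : ℝ) < d := Nat.cast_pos.2 hd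
  have hh0 : (0 : ℝ) < h := hh.trans' (by positivity)
  refine ⟨4 * √d * h, by positivity, fun i => ?_⟩
  have hbest := isBestApprox_algN hα hd (i + 1)
  have hord := addOrderOf_latticeGen_algN hα hd (i + 1)
  have hpos := hα.norm_pos hd hbest.pos
  refine meshRatio_rankOneLattice_le (two_le_algN_succ hα hd i) hord (half_pos hpos)
    (by linarith [norm_torus_le_half (algN α (i + 1) • toTorus α)]) (fun g hg hg0 =>
      hbest.half_norm_le_norm_of_mem_zmultiples (self_nsmul_latticeGen hbest.pos.ne' _)
        (mul_norm_sub_latticeGen_le hbest.pos α) hg hg0) ?_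
  set N := algN α (i + 1)
  rw [div_pow, mul_div_assoc', one_lt_div (by positivity)]
  calc (2 : ℝ) ^ d < h * c := (div_lt_iff₀ hc0).1 hh
    _ ≤ (h + 1) * (N * ‖N • toTorus α‖ ^ d) := by
      gcongr
      · linarith
      · exact hc _ hbest.pos
    _ = N * (h + 1) * ‖N • toTorus α‖ ^ d := by ring

theorem isBadlyApproximable_of_basis {F : Type*} [Field F] [NumberField F]
    (b : Module.Basis (Fin (d + 1)) ℚ F) (hb : b 0 = 1) (φ : F →ₐ[ℚ] ℝ) :
    IsBadlyApproximable fun j => φ (b j.succ) := by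
  obtain ⟨c, hc0, hc⟩ := exists_pos_le_norm_mul_norm_sub_pow b
    ((Complex.ofRealAm.restrictScalars ℚ).comp φ)
  refine ⟨c, hc0, fun N hN => ?_⟩
  set α : Fin d → ℝ := fun j => φ (b j.succ)
  let w : Fin (d + 1) → ℤ := Fin.cons N fun j => round (N * α j)
  have hw : w ≠ 0 := fun h => hN.ne' (by simpa [w] using congrFun h 0)
  have hle : ‖fun i => (w i : ℂ) - N * (φ (b i) : ℂ)‖ ≤ ‖N • toTorus α‖ := by
    rw [nsmul_toTorus, norm_toTorus_eq_norm_sub_round]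
    refine (pi_norm_le_iff_of_nonneg (norm_nonneg _)).2 (Fin.cases ?_ fun j => ?_)
    · simp [w, hb]
    · refine le_trans (le_of_eq ?_) (norm_le_pi_norm _ j)
      rw [norm_sub_rev]
      exact_mod_cast Complex.norm_real _
  have hN1 : (1 : ℝ) ≤ N := Nat.one_le_cast.2 hN
  have h := hc w hw N <| by
    rw [Complex.norm_natCast]
    exact hle.trans ((norm_torus_le_half _).trans (by linarith))
  rw [Module.finrank_eq_card_basis b, Fintype.card_fin, Nat.add_sub_cancel,
    Complex.norm_natCast] at h
  rw [distInt_natCast_mul]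
  exact h.trans (by gcongr; exact hle)

theorem isBadlyApproximable_of_linearIndependent (K : IntermediateField ℚ ℝ)
    (hK : Module.finrank ℚ K = d + 1) (hαK : ∀ j, α j ∈ K)
    (hα : LinearIndependent ℚ (Fin.cons 1 α : Fin (d + 1) → ℝ)) : IsBadlyApproximable α := by
  have : FiniteDimensional ℚ K := .of_finrank_pos (by omega)
  have : NumberField K := {}
  let v : Fin (d + 1) → K := Fin.cons 1 fun j => ⟨α j, hαK j⟩
  have hv : K.val.toLinearMap ∘ v = Fin.cons 1 α := funext (Fin.cases rfl fun _ => rfl)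
  have hvli : LinearIndependent ℚ v := .of_comp K.val.toLinearMap (hv ▸ hα)
  let b := basisOfLinearIndependentOfCardEqFinrank hvli (by simp [hK])
  have hb (i) : b i = v i := by simp [b]
  have h := isBadlyApproximable_of_basis b (hb 0) K.val
  simp only [hb] at h
  exact h

end Algorithm

end QuasiUniform

theorem theorem3p1_general (d : ℕ) (hd : 1 ≤ d) (α : Fin d → ℝ)
    (hα : QuasiUniform.IsBadlyApproximable α) :
    (∀ i, IsLeast (QuasiUniform.improvements α (QuasiUniform.algN α i))
      (QuasiUniform.algN α (i + 1))) ∧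
    QuasiUniform.IsQuasiUniformFamily
      (fun i => QuasiUniform.algN α (i + 1))
      (fun i => QuasiUniform.rankOneLattice (QuasiUniform.algN α (i + 1))
        (QuasiUniform.algZ α (i + 1))) := by
  refine ⟨QuasiUniform.isLeast_algN_succ hα hd, ?_⟩
  obtain ⟨c, hc1, hc⟩ := QuasiUniform.exists_algN_succ_le_mul hα hd
  exact {
    subset_unitCube := fun _ => QuasiUniform.rankOneLattice_subset_unitCube
    finite := fun _ => QuasiUniform.finite_rankOneLattice
    ncard_eq := fun i =>
      QuasiUniform.ncard_rankOneLattice (QuasiUniform.addOrderOf_latticeGen_algN hα hd (i + 1))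
    two_le := QuasiUniform.two_le_algN_succ hα hd
    growth := ⟨c, hc1, fun i => ⟨QuasiUniform.algN_lt_succ hα hd (i + 1), hc (i + 1)⟩⟩
    meshRatio_le := QuasiUniform.exists_meshRatio_algN_le hα hd }

/-- The first conjunct says that every search step of the algorithm succeeds, so that the sequence
is well defined; the second one is about the outputs with index `i > 1`, hence the shift. -/
theorem theorem3p1 (d : ℕ) (hd : 1 ≤ d) (α : Fin d → ℝ)
    (K : IntermediateField ℚ ℝ) (hK : Module.finrank ℚ K = d + 1)
    (hαK : ∀ j, α j ∈ K)
    (hα : LinearIndependent ℚ (Fin.cons 1 α : Fin (d + 1) → ℝ)) :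
    (∀ i, IsLeast (QuasiUniform.improvements α (QuasiUniform.algN α i))
      (QuasiUniform.algN α (i + 1))) ∧
    QuasiUniform.IsQuasiUniformFamily
      (fun i => QuasiUniform.algN α (i + 1))
      (fun i => QuasiUniform.rankOneLattice (QuasiUniform.algN α (i + 1))
        (QuasiUniform.algZ α (i + 1))) :=
  theorem3p1_general d hd α (QuasiUniform.isBadlyApproximable_of_linearIndependent K hK hαK hα)
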